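/- Let $K$ be a field and let $A$ be a finite-dimensional $K$-algebra. Write $D=\operatorname{Hom}_K(-,K)$, let $\operatorname{mod-}A$ be the category of finite-dimensional right $A$-modules, and let $\nu=D\operatorname{Hom}_A(-,A)\colon \operatorname{mod-}A\to\operatorname{mod-}A$ be the Nakayama functor (which is naturally isomorphic to $-\otimes_A D(A)$). Call $A$ \emph{gendo-symmetric} if there are a finite-dimensional symmetric $K$-algebra $B$ (that is, $B\cong D(B)$ as $B$-bimodules) and a finite-dimensional right $B$-module $M$ that is a generator (that is, $B_B$ is a direct summand of $M^n$ for some $n$) such that $A\cong\operatorname{End}_B(M)$ as $K$-algebras. Then the following are equivalent: 1. $A$ is gendo-symmetric. 2. $\nu$ is a comonad, that is, there are natural transformations $\varepsilon\colon\nu\to\operatorname{id}$ and $\delta\colon\nu\to\nu\circ\nu$ which make $\nu$ a comonad on $\operatorname{mod-}A$ (coassociative and counital). -/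

import Mathlib

open CategoryTheory

universe u

/-!
Throughout, a right module over a ring `A` is a module over `Aᵐᵒᵖ`.  A finite-dimensional right
module over a finite-dimensional algebra is the same thing as a finitely generated one, so that
the category of finite-dimensional right `A`-modules is `FGModuleCat Aᵐᵒᵖ`.
-/

/-- A `K`-algebra `B` is symmetric if it is finite-dimensional and isomorphic to its dual
`D(B) = Hom_K(B, K)` as a `B`-bimodule, where `(b • f • c) x = f (c * x * b)`. -/
def IsSymmetricAlg (K : Type u) [Field K] (B : Type u) [Ring B] [Algebra K B] : Prop :=
  FiniteDimensional K B ∧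
    ∃ φ : B ≃ₗ[K] Module.Dual K B, ∀ b y c x : B, φ (b * y * c) x = φ y (c * x * b)

/-- A right `B`-module `M` is a generator if the regular right module `B` is a direct summand
of a finite direct sum of copies of `M`. -/
def IsRightGenerator (B : Type u) [Ring B] (M : Type u) [AddCommGroup M] [Module Bᵐᵒᵖ M] : Prop :=
  ∃ (n : ℕ) (i : B →ₗ[Bᵐᵒᵖ] (Fin n → M)) (p : (Fin n → M) →ₗ[Bᵐᵒᵖ] B), p ∘ₗ i = LinearMap.id

/-- A `K`-algebra `A` is gendo-symmetric if it is isomorphic, as a `K`-algebra, to the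
endomorphism algebra of a finite-dimensional generator `M` in the category of right modules over
a finite-dimensional symmetric `K`-algebra `B`. -/
def IsGendoSymmetric (K : Type u) [Field K] (A : Type u) [Ring A] [Algebra K A] : Prop :=
  ∃ (B : Type u) (_ : Ring B) (_ : Algebra K B)
    (M : Type u) (_ : AddCommGroup M) (_ : Module K M) (_ : Module Bᵐᵒᵖ M)
    (_ : IsScalarTower K Bᵐᵒᵖ M),
    IsSymmetricAlg K B ∧ FiniteDimensional K M ∧ IsRightGenerator B M ∧
      Nonempty (A ≃ₐ[K] Module.End Bᵐᵒᵖ M)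

section Nakayama

variable (K : Type u) [Field K] (A : Type u) [Ring A] [Algebra K A]

/-- The underlying vector space `D Hom_A(X, A) = Hom_K(Hom_A(X, A), K)` of the Nakayama functor,
for a right `A`-module `X`. -/
def NakayamaObj (X : Type u) [AddCommGroup X] [Module Aᵐᵒᵖ X] : Type u :=
  Module.Dual K (X →ₗ[Aᵐᵒᵖ] A)

namespace NakayamaObj

variable (X : Type u) [AddCommGroup X] [Module Aᵐᵒᵖ X]

instance : AddCommGroup (NakayamaObj K A X) :=
  inferInstanceAs (AddCommGroup (Module.Dual K (X →ₗ[Aᵐᵒᵖ] A)))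

instance : Module K (NakayamaObj K A X) :=
  inferInstanceAs (Module K (Module.Dual K (X →ₗ[Aᵐᵒᵖ] A)))

/-- An element of `D Hom_A(X, A)` as a functional on `Hom_A(X, A)`. -/
def toDual : NakayamaObj K A X ≃ₗ[K] Module.Dual K (X →ₗ[Aᵐᵒᵖ] A) :=
  LinearEquiv.refl K (Module.Dual K (X →ₗ[Aᵐᵒᵖ] A))

variable {K A X} in
theorem ext {f g : NakayamaObj K A X} (h : ∀ t, toDual K A X f t = toDual K A X g t) : f = g :=
  (toDual K A X).injective (LinearMap.ext h)

variable {A} in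
/-- Left multiplication by `a` on the left `A`-module `Hom_A(X, A)`: `(a • h) x = a * h x`. -/
def leftMul (a : A) : (X →ₗ[Aᵐᵒᵖ] A) →ₗ[K] (X →ₗ[Aᵐᵒᵖ] A) where
  toFun h := a • h
  map_add' h h' := smul_add a h h'
  map_smul' c h := by
    ext x
    simp

instance : SMul Aᵐᵒᵖ (NakayamaObj K A X) where
  smul a f := (toDual K A X).symm (toDual K A X f ∘ₗ leftMul K X a.unop)

theorem toDual_smul (a : Aᵐᵒᵖ) (f : NakayamaObj K A X) (h : X →ₗ[Aᵐᵒᵖ] A) :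
    toDual K A X (a • f) h = toDual K A X f (a.unop • h) := rfl

/-- The right `A`-module structure on `D Hom_A(X, A)`: `(f • a) h = f (a • h)`. -/
instance : Module Aᵐᵒᵖ (NakayamaObj K A X) where
  one_smul f := ext fun h => by simp [toDual_smul]
  mul_smul a b f := ext fun h => by simp [toDual_smul, mul_smul]
  smul_zero a := ext fun h => by simp [toDual_smul]
  smul_add a f g := ext fun h => by simp [toDual_smul]
  add_smul a b f := ext fun h => by simp [toDual_smul, add_smul]
  zero_smul f := ext fun h => by simp [toDual_smul]

instance : IsScalarTower K Aᵐᵒᵖ (NakayamaObj K A X) where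
  smul_assoc c a f := ext fun h => by simp [toDual_smul]

variable {X} in
theorem finite_hom [FiniteDimensional K A] [Module.Finite Aᵐᵒᵖ X] :
    FiniteDimensional K (X →ₗ[Aᵐᵒᵖ] A) := by
  obtain ⟨n, s, hs⟩ := Module.Finite.exists_fin (R := Aᵐᵒᵖ) (M := X)
  let ev : (X →ₗ[Aᵐᵒᵖ] A) →ₗ[K] (Fin n → A) :=
    { toFun := fun h j => h (s j)
      map_add' := fun _ _ => rfl
      map_smul' := fun _ _ => rfl }
  refine FiniteDimensional.of_injective ev fun h h' hh => ?_
  exact LinearMap.ext_on_range hs fun j => congrFun hh j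

instance [FiniteDimensional K A] [Module.Finite Aᵐᵒᵖ X] :
    Module.Finite Aᵐᵒᵖ (NakayamaObj K A X) := by
  have := finite_hom K A (X := X)
  have : Module.Finite K (NakayamaObj K A X) :=
    inferInstanceAs (Module.Finite K (Module.Dual K (X →ₗ[Aᵐᵒᵖ] A)))
  exact Module.Finite.of_restrictScalars_finite K Aᵐᵒᵖ _

variable {X} {Y : Type u} [AddCommGroup Y] [Module Aᵐᵒᵖ Y]

/-- The map `D Hom_A(g, A) : D Hom_A(X, A) → D Hom_A(Y, A)` induced by `g : X → Y`. It sends `f`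
to the functional `h ↦ f (h ∘ g)`. -/
def map (g : X →ₗ[Aᵐᵒᵖ] Y) : NakayamaObj K A X →ₗ[Aᵐᵒᵖ] NakayamaObj K A Y where
  toFun f := (toDual K A Y).symm (toDual K A X f ∘ₗ
    { toFun := fun h => h ∘ₗ g
      map_add' := fun _ _ => rfl
      map_smul' := fun _ _ => rfl })
  map_add' _ _ := rfl
  map_smul' _ _ := rfl

theorem toDual_map (g : X →ₗ[Aᵐᵒᵖ] Y) (f : NakayamaObj K A X) (h : Y →ₗ[Aᵐᵒᵖ] A) :
    toDual K A Y (map K A g f) h = toDual K A X f (h ∘ₗ g) := rfl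

end NakayamaObj

/-- The Nakayama functor `ν = D Hom_A(-, A)` on the category of finite-dimensional right
modules over a finite-dimensional `K`-algebra `A`. -/
def nakayamaFunctor [FiniteDimensional K A] : FGModuleCat.{u} Aᵐᵒᵖ ⥤ FGModuleCat.{u} Aᵐᵒᵖ where
  obj X := FGModuleCat.of Aᵐᵒᵖ (NakayamaObj K A X)
  map g := FGModuleCat.ofHom (NakayamaObj.map K A g.hom.hom)
  map_id _ := rfl
  map_comp _ _ := rfl

end Nakayama

/-! Both conditions are equivalent to the existence of a bimodule map ε : D(A) → A with ε(c)c' =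
cε(c') for which a ↦ aε is a bijection from A to Hom_A(D(A), A); this is `IsNakayamaCounit`. Under ν
≅ - ⊗ D(A), such an ε extends to ε_X : νX → X. The bijection makes every νε_X invertible and the
exchange identity gives νε = εν, so the inverse of νε is a comultiplication (`exists_comonad`).
Conversely, End(D(A)) = A and the two counit laws force the component at A of any comonad counit to
have these properties (`of_counital`). If A = End_B(M) with B symmetric, then Hom_B(M, B) ≅ D(M),
and ε is dual to the map M ⊗ D(M) → A given by endomorphisms factoring through B. The generator
property gives the bijection (`IsGendoSymmetric.exists_isNakayamaCounit`). Conversely, the image of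
ε is an idempotent ideal, hence AeA for an idempotent e in it. The exchange identity makes eAe
symmetric (`isSymmetricAlg_corner`), and the bijection yields A ≅ End_{eAe}(Ae) (`bijective_toEnd`),
where Ae is a generator. -/

section IdempotentComonad

variable {C : Type*} [Category C]

/-- A functor with a transformation `ε` to the identity such that `F ε = ε F` is invertible is
the underlying functor of an (idempotent) comonad. -/
noncomputable def idempotentComonad (F : C ⥤ C) (ε : F ⟶ 𝟭 C) [∀ X, IsIso (F.map (ε.app X))]
    (h : ∀ X, F.map (ε.app X) = ε.app (F.obj X)) : Comonad C where
  toFunctor := F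
  ε := ε
  δ :=
    { app := fun X => inv (F.map (ε.app X))
      naturality := fun X Y f => by
        rw [IsIso.comp_inv_eq, Category.assoc, IsIso.eq_inv_comp]
        change _ = F.map (F.map f) ≫ _
        rw [← F.map_comp, ← F.map_comp]
        exact congrArg F.map (ε.naturality f).symm }
  coassoc X := by
    have : F.map (inv (F.map (ε.app X))) = inv (F.map (ε.app (F.obj X))) := by
      rw [Functor.map_inv, IsIso.inv_eq_inv, h X]
    rw [this]
  left_counit X := by simp [← h]
  right_counit X := by simp

end IdempotentComonad

/-- A subspace of the dual of a finite-dimensional space is everything if it separates points. -/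
theorem Module.Dual.eq_top_of_separating {K V : Type*} [Field K] [AddCommGroup V] [Module K V]
    [FiniteDimensional K V] (S : Submodule K (Module.Dual K V))
    (h : ∀ v : V, (∀ f ∈ S, f v = 0) → v = 0) : S = ⊤ := by
  have h1 : S.dualCoannihilator = ⊥ := by
    rw [eq_bot_iff]
    intro v hv
    rw [Submodule.mem_dualCoannihilator] at hv
    exact h v hv
  rw [← Subspace.dualCoannihilator_dualAnnihilator_eq (W := S), h1,
    Submodule.dualAnnihilator_bot]

/-! ### The intermediate condition on ε, and the elements x ⊗ c of νX -/

section

variable {K : Type u} [Field K] {A : Type u} [Ring A] [Algebra K A]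

/-- A map of bimodules `ε : D(A) → A` satisfying `ε(c) c' = c ε(c')` in `D(A)` and such that
`a ↦ a ε` is a bijection from `A` to the right linear maps `D(A) → A`. -/
structure IsNakayamaCounit (ε : Module.Dual K A →ₗ[K] A) : Prop where
  map_mulRight : ∀ a c, ε (c ∘ₗ LinearMap.mulRight K a) = a * ε c
  map_mulLeft : ∀ a c, ε (c ∘ₗ LinearMap.mulLeft K a) = ε c * a
  comm : ∀ (c c' : Module.Dual K A) (x : A), c' (x * ε c) = c (ε c' * x)
  faithful : ∀ a, (∀ c, a * ε c = 0) → a = 0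
  full : ∀ f : Module.Dual K A →ₗ[K] A, (∀ a c, f (c ∘ₗ LinearMap.mulLeft K a) = f c * a) →
    ∃ a, ∀ c, f c = a * ε c

end

namespace NakayamaObj

variable (K : Type u) [Field K] {A : Type u} [Ring A] [Algebra K A]
variable {X : Type u} [AddCommGroup X] [Module Aᵐᵒᵖ X]
variable {Y : Type u} [AddCommGroup Y] [Module Aᵐᵒᵖ Y]

/-- The element of `D Hom_A(X, A)` given by `h ↦ c (h x)`; it corresponds to `x ⊗ c` under
`D Hom_A(X, A) ≃ X ⊗ D(A)`. -/
def tmul (x : X) : Module.Dual K A →ₗ[K] NakayamaObj K A X where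
  toFun c := (toDual K A X).symm
    { toFun := fun h => c (h x)
      map_add' := fun h h' => by simp
      map_smul' := fun k h => by simp }
  map_add' _ _ := rfl
  map_smul' _ _ := rfl

theorem toDual_tmul (x : X) (c : Module.Dual K A) (h : X →ₗ[Aᵐᵒᵖ] A) :
    toDual K A X (tmul K x c) h = c (h x) := rfl

theorem map_tmul (g : X →ₗ[Aᵐᵒᵖ] Y) (x : X) (c : Module.Dual K A) :
    map K A g (tmul K x c) = tmul K (g x) c := rfl

theorem smul_tmul (a : A) (x : X) (c : Module.Dual K A) :
    MulOpposite.op a • tmul K x c = tmul K x (c ∘ₗ LinearMap.mulLeft K a) := rfl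

theorem tmul_smul (a : A) (x : X) (c : Module.Dual K A) :
    tmul K (MulOpposite.op a • x) c = tmul K x (c ∘ₗ LinearMap.mulRight K a) :=
  ext fun h => by simp [toDual_tmul]

theorem tmul_add (x y : X) (c : Module.Dual K A) :
    tmul K (x + y) c = tmul K x c + tmul K y c :=
  ext fun h => by simp [toDual_tmul]

variable {K}

/-- A homomorphism h with c(h x) = 0 for all x and c vanishes, so the elements x ⊗ c separate the
points of Hom_A(X, A) and span its dual. This stands in for νX ≅ X ⊗ D(A). -/
theorem eq_top_of_tmul_mem [FiniteDimensional K A] [Module.Finite Aᵐᵒᵖ X]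
    (S : Submodule Aᵐᵒᵖ (NakayamaObj K A X)) (h : ∀ x c, tmul K x c ∈ S) : S = ⊤ := by
  have := finite_hom K A (X := X)
  have key := Module.Dual.eq_top_of_separating (K := K) (V := X →ₗ[Aᵐᵒᵖ] A)
    ((S.restrictScalars K).map (toDual K A X).toLinearMap) fun t ht => by
      refine LinearMap.ext fun x => ?_
      refine (Module.forall_dual_apply_eq_zero_iff K _).1 fun c => ?_
      exact ht _ ⟨tmul K x c, h x c, rfl⟩
  rw [eq_top_iff]
  intro f _
  have : toDual K A X f ∈ (S.restrictScalars K).map (toDual K A X).toLinearMap := by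
    rw [key]; trivial
  obtain ⟨g, hg, hgf⟩ := this
  rwa [← (toDual K A X).injective hgf]

theorem hom_ext_tmul [FiniteDimensional K A] [Module.Finite Aᵐᵒᵖ X]
    {u v : NakayamaObj K A X →ₗ[Aᵐᵒᵖ] Y} (h : ∀ x c, u (tmul K x c) = v (tmul K x c)) : u = v :=
  LinearMap.eqLocus_eq_top.1 (eq_top_of_tmul_mem _ h)

end NakayamaObj

/-! ### From ε to an idempotent comonad -/

namespace IsNakayamaCounit

open NakayamaObj

variable {K : Type u} [Field K] {A : Type u} [Ring A] [Algebra K A] [FiniteDimensional K A]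
variable {ε : Module.Dual K A →ₗ[K] A}
variable (X : Type u) [AddCommGroup X] [Module Aᵐᵒᵖ X] [Module.Finite Aᵐᵒᵖ X]

/-- Defined by double duality: φ in D(X) gives a map `hom φ` : X → A with c(`hom φ` x) = φ(x ε(c)),
and t f is the vector on which each φ takes the value f(`hom φ`). -/
theorem exists_counit (hε : IsNakayamaCounit ε) : ∃ t : NakayamaObj K A X →ₗ[Aᵐᵒᵖ] X,
    ∀ x c, t (tmul K x c) = MulOpposite.op (ε c) • x := by
  let : Module K X := Module.compHom X (algebraMap K Aᵐᵒᵖ)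
  have : IsScalarTower K Aᵐᵒᵖ X := ⟨fun k a x => by
    rw [Algebra.smul_def, mul_smul]; rfl⟩
  have : FiniteDimensional K X := Module.Finite.trans Aᵐᵒᵖ X
  have ext_dual {V : Type u} [AddCommGroup V] [Module K V] [FiniteDimensional K V] {a b : V}
      (h : ∀ c : Module.Dual K V, c a = c b) : a = b :=
    (Module.evalEquiv K V).injective (LinearMap.ext h)
  have exists_hom (φ : Module.Dual K X) (x : X) :
      ∃ b : A, ∀ c : Module.Dual K A, c b = φ (MulOpposite.op (ε c) • x) := by
    obtain ⟨b, hb⟩ := (Module.evalEquiv K A).surjective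
      { toFun := fun c => φ (MulOpposite.op (ε c) • x)
        map_add' := fun c c' => by simp [add_smul]
        map_smul' := fun k c => by simp }
    exact ⟨b, fun c => LinearMap.congr_fun hb c⟩
  choose hom₀ hom₀_spec using exists_hom
  let hom (φ : Module.Dual K X) : X →ₗ[Aᵐᵒᵖ] A :=
    { toFun := hom₀ φ
      map_add' := fun x y => ext_dual fun c => by simp [hom₀_spec]
      map_smul' := fun a x => ext_dual fun c => by
        have h : c (a • hom₀ φ x) = (c ∘ₗ LinearMap.mulRight K a.unop) (hom₀ φ x) := rfl
        rw [RingHom.id_apply, h, hom₀_spec, hom₀_spec, hε.map_mulRight, MulOpposite.op_mul,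
          mul_smul, MulOpposite.op_unop] }
  have hom_spec (φ : Module.Dual K X) (x : X) (c : Module.Dual K A) :
      c (hom φ x) = φ (MulOpposite.op (ε c) • x) := hom₀_spec φ x c
  let homₗ : Module.Dual K X →ₗ[K] (X →ₗ[Aᵐᵒᵖ] A) :=
    { toFun := hom
      map_add' := fun φ ψ => LinearMap.ext fun x => ext_dual fun c => by simp [hom_spec]
      map_smul' := fun k φ => LinearMap.ext fun x => ext_dual fun c => by simp [hom_spec] }
  let t (f : NakayamaObj K A X) : X :=
    (Module.evalEquiv K X).symm (toDual K A X f ∘ₗ homₗ)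
  have t_spec (f : NakayamaObj K A X) (φ : Module.Dual K X) : φ (t f) = toDual K A X f (hom φ) := by
    simp [t, homₗ]
  refine ⟨{ toFun := t, map_add' := fun f g => ext_dual fun φ => ?_,
            map_smul' := fun a f => ext_dual fun φ => ?_ }, fun x c => ext_dual fun φ => ?_⟩
  · simp [t_spec]
  · have h1 (y : X) : φ (a • y) = (φ ∘ₗ Module.toModuleEnd K (S := Aᵐᵒᵖ) X a) y := rfl
    rw [RingHom.id_apply, h1, t_spec, t_spec, toDual_smul]
    congr 1
    refine LinearMap.ext fun x => ext_dual fun c => ?_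
    have h2 : c ((a.unop • hom φ) x) = (c ∘ₗ LinearMap.mulLeft K a.unop) (hom φ x) := rfl
    rw [hom_spec, h2, hom_spec, hε.map_mulLeft, MulOpposite.op_mul, mul_smul,
      MulOpposite.op_unop, h1]
  · exact (t_spec _ φ).trans (hom_spec φ x c)

/-- The extension of `ε` to a map `D Hom_A(X, A) → X`, `x ⊗ c ↦ x ε(c)`. -/
noncomputable def counit (hε : IsNakayamaCounit ε) : NakayamaObj K A X →ₗ[Aᵐᵒᵖ] X :=
  (hε.exists_counit X).choose

variable {X}

theorem counit_tmul (hε : IsNakayamaCounit ε) (x : X) (c : Module.Dual K A) :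
    hε.counit X (tmul K x c) = MulOpposite.op (ε c) • x :=
  (hε.exists_counit X).choose_spec x c

theorem counit_naturality (hε : IsNakayamaCounit ε) {Y : Type u} [AddCommGroup Y] [Module Aᵐᵒᵖ Y]
    [Module.Finite Aᵐᵒᵖ Y] (g : X →ₗ[Aᵐᵒᵖ] Y) :
    hε.counit Y ∘ₗ map K A g = g ∘ₗ hε.counit X :=
  hom_ext_tmul fun x c => by simp [map_tmul, counit_tmul]

theorem map_counit (hε : IsNakayamaCounit ε) :
    map K A (hε.counit X) = hε.counit (NakayamaObj K A X) := by
  refine hom_ext_tmul fun f c' => ?_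
  let S : Submodule Aᵐᵒᵖ (NakayamaObj K A X) :=
    { carrier := {f | ∀ c', map K A (hε.counit X) (tmul K f c') =
        hε.counit (NakayamaObj K A X) (tmul K f c')}
      zero_mem' := fun c' => by
        have h : tmul K (0 : NakayamaObj K A X) c' = 0 := ext fun h => by simp [toDual_tmul]
        rw [h, map_zero, map_zero]
      add_mem' := fun hf hg c' => by rw [tmul_add, map_add, map_add, hf, hg]
      smul_mem' := fun a f hf c' => by
        rw [← MulOpposite.op_unop a, tmul_smul, hf] }
  -- On (x ⊗ c) ⊗ c' the two sides are x ⊗ ε(c)c' and x ⊗ cε(c'), equal by the exchange identity.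
  have hS : S = ⊤ := eq_top_of_tmul_mem S fun x c c' => by
    rw [map_tmul, counit_tmul, counit_tmul, tmul_smul, smul_tmul]
    exact congrArg _ (LinearMap.ext fun y => hε.comm c c' y)
  have : f ∈ S := hS ▸ Submodule.mem_top
  exact this c'

/-- By duality it suffices that composition with ε_X is a bijection Hom(X, A) → Hom(νX, A). For
fixed x, a map g on νX restricts to c ↦ g(x ⊗ c), which is aε for a unique a; that a is the value at
x of the preimage of g. -/
theorem bijective_map_counit (hε : IsNakayamaCounit ε) :
    Function.Bijective (map K A (hε.counit X)) := by
  let P : (X →ₗ[Aᵐᵒᵖ] A) →ₗ[K] (NakayamaObj K A X →ₗ[Aᵐᵒᵖ] A) :=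
    { toFun := fun h => h ∘ₗ hε.counit X
      map_add' := fun _ _ => rfl
      map_smul' := fun _ _ => rfl }
  have hP : Function.Bijective P := by
    constructor
    · rw [injective_iff_map_eq_zero]
      intro h hh
      refine LinearMap.ext fun x => hε.faithful _ fun c => ?_
      have := LinearMap.congr_fun hh (tmul K x c)
      simpa [P, counit_tmul] using this
    · intro g
      have key (x : X) : ∃ a : A, ∀ c, g (tmul K x c) = a * ε c :=
        hε.full (g.restrictScalars K ∘ₗ tmul K x) fun a c => by
          have := g.map_smul (MulOpposite.op a) (tmul K x c)
          rwa [smul_tmul] at this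
      choose h hh using key
      have uniq {a b : A} (H : ∀ c, a * ε c = b * ε c) : a = b :=
        sub_eq_zero.1 (hε.faithful _ fun c => by rw [sub_mul, H, sub_self])
      have h_smul (a : Aᵐᵒᵖ) (x : X) : h (a • x) = a • h x := uniq fun c => by
        rw [← hh, ← MulOpposite.op_unop a, tmul_smul, hh, hε.map_mulRight, ← mul_assoc]
        rfl
      refine ⟨{ toFun := h
                map_add' := fun x y => uniq fun c => ?_
                map_smul' := h_smul }, hom_ext_tmul fun x c => ?_⟩
      · rw [add_mul, ← hh, ← hh, ← hh, tmul_add, map_add]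
      · simp [P, counit_tmul, hh, h_smul]
  exact LinearMap.dualMap_bijective_iff.2 hP

theorem exists_comonad (hε : IsNakayamaCounit ε) :
    ∃ G : Comonad (FGModuleCat.{u} Aᵐᵒᵖ), G.toFunctor = nakayamaFunctor K A := by
  let η : nakayamaFunctor K A ⟶ 𝟭 _ :=
    { app := fun X => FGModuleCat.ofHom (hε.counit X)
      naturality := fun X Y g => FGModuleCat.hom_ext (hε.counit_naturality g.hom.hom) }
  have (X : FGModuleCat.{u} Aᵐᵒᵖ) : IsIso ((nakayamaFunctor K A).map (η.app X)) :=
    (LinearEquiv.ofBijective _ (hε.bijective_map_counit (X := X))).toFGModuleCatIso.isIso_hom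
  exact ⟨idempotentComonad (nakayamaFunctor K A) η
    fun X => FGModuleCat.hom_ext hε.map_counit, rfl⟩

end IsNakayamaCounit

/-! ### From a comonad to ε -/

namespace NakayamaObj

variable (K : Type u) [Field K] {A : Type u} [Ring A] [Algebra K A]
variable {X : Type u} [AddCommGroup X] [Module Aᵐᵒᵖ X]

/-- The map of right modules `A → X`, `a ↦ x a`. -/
def orbitMap (x : X) : A →ₗ[Aᵐᵒᵖ] X where
  toFun a := MulOpposite.op a • x
  map_add' a b := by simp [add_smul]
  map_smul' a b := by simp [mul_smul]

theorem orbitMap_apply (x : X) (a : A) : orbitMap x a = MulOpposite.op a • x := rfl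

theorem orbitMap_one (x : X) : orbitMap x (1 : A) = x := by simp [orbitMap_apply]

theorem orbitMap_map_one (h : A →ₗ[Aᵐᵒᵖ] X) : orbitMap (h 1) = h :=
  LinearMap.ext fun a => by rw [orbitMap_apply, ← map_smul]; simp

theorem map_orbitMap (x : X) (c : Module.Dual K A) :
    map K A (orbitMap x) (tmul K 1 c) = tmul K x c := by
  rw [map_tmul, orbitMap_one]

/-- The identification of `D Hom_A(A, A)` with `D(A)`. -/
def toDualSelf : NakayamaObj K A A →ₗ[K] Module.Dual K A where
  toFun f :=
    { toFun := fun a => toDual K A A f (orbitMap a)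
      map_add' := fun a b => by
        rw [← map_add]; congr 1; ext; simp [orbitMap_apply]
      map_smul' := fun k a => by
        rw [RingHom.id_apply, ← map_smul]; congr 1; ext; simp [orbitMap_apply] }
  map_add' _ _ := rfl
  map_smul' _ _ := rfl

theorem toDualSelf_apply (f : NakayamaObj K A A) (a : A) :
    toDualSelf K f a = toDual K A A f (orbitMap a) := rfl

theorem toDualSelf_tmul (c : Module.Dual K A) : toDualSelf K (tmul K 1 c) = c :=
  LinearMap.ext fun a => by rw [toDualSelf_apply, toDual_tmul, orbitMap_one]

theorem tmul_toDualSelf (f : NakayamaObj K A A) : tmul K 1 (toDualSelf K f) = f :=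
  ext fun h => by rw [toDual_tmul, toDualSelf_apply, orbitMap_map_one]

theorem toDualSelf_smul (a : A) (f : NakayamaObj K A A) :
    toDualSelf K (MulOpposite.op a • f) = toDualSelf K f ∘ₗ LinearMap.mulLeft K a := by
  conv_lhs => rw [← tmul_toDualSelf K f, smul_tmul, toDualSelf_tmul]

variable {K}

/-- Every endomorphism of the right module `D(A)` is left multiplication by an element of `A`. -/
theorem exists_endomorphism_eq [FiniteDimensional K A]
    (u : NakayamaObj K A A →ₗ[Aᵐᵒᵖ] NakayamaObj K A A) :
    ∃ a : A, ∀ c, u (tmul K 1 c) = tmul K a c := by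
  -- The element a represents the functional c ↦ u(c)(1) on D(A); right linearity then recovers
  -- u(c)(b) as u(cb)(1).
  obtain ⟨a, ha⟩ := (Module.evalEquiv K A).surjective
    { toFun := fun c => toDualSelf K (u (tmul K 1 c)) 1
      map_add' := fun c c' => by simp
      map_smul' := fun k c => by
        have h : u (tmul K 1 (k • c)) = k • u (tmul K 1 c) := by
          rw [map_smul, LinearMap.map_smul_of_tower]
        rw [h]
        simp }
  have ha' (c : Module.Dual K A) : toDualSelf K (u (tmul K 1 c)) 1 = c a :=
    (LinearMap.congr_fun ha c).symm
  refine ⟨a, fun c => ?_⟩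
  rw [← tmul_toDualSelf K (u _), ← tmul_toDualSelf K (tmul K a c)]
  congr 1
  ext b
  have h1 := ha' (c ∘ₗ LinearMap.mulLeft K b)
  rw [← smul_tmul, map_smul, toDualSelf_smul] at h1
  simpa [toDualSelf_apply, toDual_tmul, orbitMap_apply] using h1

end NakayamaObj

open NakayamaObj in
-- For f : νA → A, the endomorphism ν(f) ∘ d of D(A) is left multiplication by some a, and the left
-- counit law with naturality gives f = a e. Hence ν(e) is injective, so by the right counit law it
-- is inverse to d; as also e' ∘ d = id, ν(e) = e'. The exchange identity is this equality evaluated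
-- on c ⊗ c'.
theorem IsNakayamaCounit.of_counital {K : Type u} [Field K] {A : Type u} [Ring A]
    [Algebra K A] [FiniteDimensional K A]
    (e : NakayamaObj K A A →ₗ[Aᵐᵒᵖ] A)
    (e' : NakayamaObj K A (NakayamaObj K A A) →ₗ[Aᵐᵒᵖ] NakayamaObj K A A)
    (d : NakayamaObj K A A →ₗ[Aᵐᵒᵖ] NakayamaObj K A (NakayamaObj K A A))
    (e_nat : ∀ (g : A →ₗ[Aᵐᵒᵖ] A) x, e (map K A g x) = g (e x))
    (e'_nat : ∀ (g : A →ₗ[Aᵐᵒᵖ] NakayamaObj K A A) x, e' (map K A g x) = g (e x))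
    (e_nat' : ∀ (g : NakayamaObj K A A →ₗ[Aᵐᵒᵖ] A) x, e (map K A g x) = g (e' x))
    (left_counit : ∀ x, e' (d x) = x) (right_counit : ∀ x, map K A e (d x) = x) :
    IsNakayamaCounit (e.restrictScalars K ∘ₗ tmul K (1 : A)) := by
  have full (f : NakayamaObj K A A →ₗ[Aᵐᵒᵖ] A) : ∃ a, f = orbitMap a ∘ₗ e := by
    obtain ⟨a, ha⟩ := exists_endomorphism_eq (map K A f ∘ₗ d)
    refine ⟨a, LinearMap.ext fun x => ?_⟩
    rw [LinearMap.comp_apply, ← e_nat]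
    conv_lhs => rw [← left_counit x, ← e_nat']
    rw [← tmul_toDualSelf K x]
    have := ha (toDualSelf K x)
    rw [LinearMap.comp_apply] at this
    rw [this, map_orbitMap]
  have map_e_injective : Function.Injective (map K A e) := by
    rw [injective_iff_map_eq_zero]
    refine fun n hn => ext fun f => ?_
    obtain ⟨a, rfl⟩ := full f
    rw [← toDual_map, hn]
    simp
  have map_e : map K A e = e' := LinearMap.ext fun n => by
    conv_rhs => rw [← map_e_injective (right_counit (map K A e n))]
    rw [left_counit]
  constructor
  · intro a c
    have h := e_nat (orbitMap a) (tmul K 1 c)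
    rw [map_orbitMap, orbitMap_apply] at h
    rw [LinearMap.comp_apply, ← tmul_smul, (by simp : MulOpposite.op a • (1 : A) = a)]
    exact h
  · intro a c
    simp [← smul_tmul]
  · intro c c' x
    have h := e'_nat (orbitMap (tmul K 1 c)) (tmul K 1 c')
    rw [← map_e, map_orbitMap, map_tmul] at h
    simpa [orbitMap_apply, toDual_tmul, smul_tmul] using
      congrArg (fun n => toDual K A A n (orbitMap x)) h
  · intro a ha
    have h0 : orbitMap a ∘ₗ e = 0 := LinearMap.ext fun x => by
      rw [← tmul_toDualSelf K x]
      exact ha _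
    have h1 (x) : map K A (orbitMap a) x = 0 := by
      rw [← right_counit x, ← LinearMap.comp_apply]
      change map K A (orbitMap a ∘ₗ e) (d x) = 0
      rw [h0]
      exact ext fun h => by simp [toDual_map]
    refine (Module.forall_dual_apply_eq_zero_iff K a).1 fun c => ?_
    have h2 := h1 (tmul K 1 c)
    rw [map_orbitMap] at h2
    simpa [toDual_tmul] using congrArg (fun n => toDual K A A n LinearMap.id) h2
  · intro f hf
    obtain ⟨a, ha⟩ := full
      { toFun := fun n => f (toDualSelf K n)
        map_add' := fun _ _ => by simp
        map_smul' := fun b n => by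
          rw [← MulOpposite.op_unop b, toDualSelf_smul, hf]; rfl }
    refine ⟨a, fun c => ?_⟩
    have := LinearMap.congr_fun ha (tmul K 1 c)
    simpa [toDualSelf_tmul, orbitMap_apply] using this

open NakayamaObj in
theorem exists_isNakayamaCounit_of_comonad {K : Type u} [Field K] {A : Type u} [Ring A]
    [Algebra K A] [FiniteDimensional K A]
    (h : ∃ G : Comonad (FGModuleCat.{u} Aᵐᵒᵖ), G.toFunctor = nakayamaFunctor K A) :
    ∃ ε : Module.Dual K A →ₗ[K] A, IsNakayamaCounit ε := by
  obtain ⟨G, hG⟩ := h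
  -- Destructuring allows the equality of functors to be substituted, so that `η` and `δ` become
  -- transformations of ν itself.
  cases G with | mk F η δ _ hl hr => ?_
  dsimp only at hG
  subst hG
  have : Module.Finite Aᵐᵒᵖ A := Module.Finite.of_restrictScalars_finite K Aᵐᵒᵖ A
  let P := FGModuleCat.of Aᵐᵒᵖ A
  let N := (nakayamaFunctor K A).obj P
  let e : NakayamaObj K A A →ₗ[Aᵐᵒᵖ] A := (η.app P).hom.hom
  let e' : NakayamaObj K A (NakayamaObj K A A) →ₗ[Aᵐᵒᵖ] NakayamaObj K A A := (η.app N).hom.hom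
  let d : NakayamaObj K A A →ₗ[Aᵐᵒᵖ] NakayamaObj K A (NakayamaObj K A A) := (δ.app P).hom.hom
  refine ⟨_, IsNakayamaCounit.of_counital e e' d (fun g x => ?_) (fun g x => ?_) (fun g x => ?_)
    (fun x => ?_) fun x => ?_⟩
  · exact LinearMap.congr_fun (congrArg (fun f => f.hom.hom)
      (η.naturality (X := P) (Y := P) (FGModuleCat.ofHom g))) x
  · exact LinearMap.congr_fun (congrArg (fun f => f.hom.hom)
      (η.naturality (X := P) (Y := N) (FGModuleCat.ofHom g))) x
  · exact LinearMap.congr_fun (congrArg (fun f => f.hom.hom)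
      (η.naturality (X := N) (Y := P) (FGModuleCat.ofHom g))) x
  · exact LinearMap.congr_fun (congrArg (fun f => f.hom.hom) (hl P)) x
  · exact LinearMap.congr_fun (congrArg (fun f => f.hom.hom) (hr P)) x

/-! ### From a generator over a symmetric algebra to ε -/

/-- A symmetric algebra has a nondegenerate symmetric trace form. -/
theorem IsSymmetricAlg.exists_trace {K : Type u} [Field K] {B : Type u} [Ring B] [Algebra K B]
    (hB : IsSymmetricAlg K B) : ∃ τ : Module.Dual K B, (∀ x y, τ (x * y) = τ (y * x)) ∧
      (∀ f : Module.Dual K B, ∃ s, ∀ b, τ (s * b) = f b) ∧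
      ∀ s s' : B, (∀ b, τ (s * b) = τ (s' * b)) → s = s' := by
  obtain ⟨-, φ, hφ⟩ := hB
  have h1 (y x : B) : φ y x = φ 1 (x * y) := by simpa using hφ y 1 1 x
  have h2 (y x : B) : φ y x = φ 1 (y * x) := by simpa using hφ 1 1 y x
  refine ⟨φ 1, fun x y => by rw [← h1, ← h2], fun f => ⟨φ.symm f, fun b => ?_⟩, fun s s' h => ?_⟩
  · rw [← h2, LinearEquiv.apply_symm_apply]
  · refine φ.injective (LinearMap.ext fun b => ?_)
    rw [h2 s, h2 s', h]

open NakayamaObj in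
-- The trace form identifies ψ in D(M) with `sharp ψ` in Hom_B(M, B), and ε is defined by ψ(ε(c)m) =
-- c(`θ m ψ`). Matrix coefficients span D(A) because M is faithful over A, and symmetry of τ gives
-- ε(`coeff m φ`) = `θ m φ`, which reduces the identities to computations in M.
theorem IsGendoSymmetric.exists_isNakayamaCounit {K : Type u} [Field K] {A : Type u} [Ring A]
    [Algebra K A] [FiniteDimensional K A] (hA : IsGendoSymmetric K A) :
    ∃ ε : Module.Dual K A →ₗ[K] A, IsNakayamaCounit ε := by
  obtain ⟨B, _, _, M, _, _, _, _, hB, _, ⟨n, i, p, hip⟩, ⟨α⟩⟩ := hA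
  obtain ⟨τ, τ_comm, τ_surj, τ_inj⟩ := hB.exists_trace
  have ext_dual {V : Type u} [AddCommGroup V] [Module K V] [FiniteDimensional K V] {a b : V}
      (h : ∀ c : Module.Dual K V, c a = c b) : a = b :=
    (Module.evalEquiv K V).injective (LinearMap.ext h)
  have ext_α {a b : A} (h : ∀ m, α a m = α b m) : a = b := α.injective (LinearMap.ext h)
  have smul_lin (k : K) (b : B) (m : M) :
      MulOpposite.op (k • b) • m = k • MulOpposite.op b • m := by
    rw [MulOpposite.op_smul, smul_assoc]
  -- the right linear map `M → B` attached to a functional on `M`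
  have exists_sharp (ψ : Module.Dual K M) :
      ∃ s : M →ₗ[Bᵐᵒᵖ] B, ∀ m b, τ (s m * b) = ψ (MulOpposite.op b • m) := by
    choose s hs using fun m => τ_surj
      { toFun := fun b => ψ (MulOpposite.op b • m)
        map_add' := fun b b' => by simp [add_smul]
        map_smul' := fun k b => by simp }
    refine ⟨{ toFun := s, map_add' := fun m m' => τ_inj _ _ fun b => ?_,
              map_smul' := fun c m => τ_inj _ _ fun b => ?_ }, hs⟩
    · rw [add_mul, map_add, hs, hs, hs]; simp
    · rw [← MulOpposite.op_unop c, hs]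
      simp [mul_assoc, hs, mul_smul]
  choose sharp sharp_spec using exists_sharp
  have sharp_eq {ψ : Module.Dual K M} {m : M} {s : B}
      (h : ∀ b, τ (s * b) = ψ (MulOpposite.op b • m)) : sharp ψ m = s :=
    τ_inj _ _ fun b => by rw [sharp_spec, h]
  let θ (m : M) (ψ : Module.Dual K M) : A := α.symm (orbitMap m ∘ₗ sharp ψ)
  have θ_spec (m : M) (ψ : Module.Dual K M) (x : M) :
      α (θ m ψ) x = MulOpposite.op (sharp ψ x) • m := by
    simp [θ, orbitMap_apply]
  let pre (ψ : Module.Dual K M) (a : A) : Module.Dual K M := ψ ∘ₗ (α a).restrictScalars K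
  have mul_θ (a : A) (m : M) (ψ : Module.Dual K M) : a * θ m ψ = θ (α a m) ψ :=
    ext_α fun x => by simp [θ_spec]
  have θ_mul (a : A) (m : M) (ψ : Module.Dual K M) : θ m ψ * a = θ m (pre ψ a) :=
    ext_α fun x => by
      rw [map_mul, Module.End.mul_apply, θ_spec, θ_spec]
      congr 2
      exact (sharp_eq fun b => by rw [sharp_spec]; simp [pre]).symm
  have exists_ε (c : Module.Dual K A) : ∃ a, ∀ m ψ, ψ (α a m) = c (θ m ψ) := by
    have key (m : M) : ∃ m', ∀ ψ : Module.Dual K M, ψ m' = c (θ m ψ) := by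
      obtain ⟨m', hm'⟩ := (Module.evalEquiv K M).surjective
        { toFun := fun ψ => c (θ m ψ)
          map_add' := fun ψ ψ' => by
            rw [← map_add]
            congr 1
            refine ext_α fun x => ?_
            simp only [map_add, LinearMap.add_apply, θ_spec]
            rw [← add_smul, ← MulOpposite.op_add]
            congr 2
            exact sharp_eq fun b => by simp [add_mul, sharp_spec]
          map_smul' := fun k ψ => by
            rw [RingHom.id_apply, ← map_smul]
            congr 1
            refine ext_α fun x => ?_
            simp only [map_smul, LinearMap.smul_apply, θ_spec]
            rw [← smul_lin]
            congr 2
            exact sharp_eq fun b => by simp [sharp_spec] }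
      exact ⟨m', fun ψ => LinearMap.congr_fun hm' ψ⟩
    choose g hg using key
    refine ⟨α.symm
      { toFun := g
        map_add' := fun m m' => ext_dual fun ψ => ?_
        map_smul' := fun b m => ext_dual fun ψ => ?_ }, fun m ψ => by simp [hg]⟩
    · rw [map_add, hg, hg, hg, ← map_add]
      congr 1
      exact ext_α fun x => by simp [θ_spec]
    · have h1 : ψ (b • g m) = (ψ ∘ₗ Module.toModuleEnd K (S := Bᵐᵒᵖ) M b) (g m) := rfl
      rw [RingHom.id_apply, h1, hg, hg]
      congr 1
      refine ext_α fun x => ?_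
      rw [θ_spec, θ_spec, smul_smul, ← MulOpposite.op_unop b, ← MulOpposite.op_mul]
      congr 2
      refine (sharp_eq fun b' => ?_).symm
      rw [mul_assoc, τ_comm, mul_assoc, sharp_spec]
      simp [mul_smul]
  choose ε₀ ε₀_spec using exists_ε
  have ε₀_eq {c : Module.Dual K A} {a : A} (h : ∀ m ψ, ψ (α a m) = c (θ m ψ)) : ε₀ c = a :=
    ext_α fun m => ext_dual fun ψ => by rw [ε₀_spec, h]
  let ε : Module.Dual K A →ₗ[K] A :=
    { toFun := ε₀
      map_add' := fun c c' => ε₀_eq fun m ψ => by simp [ε₀_spec]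
      map_smul' := fun k c => ε₀_eq fun m ψ => by simp [ε₀_spec] }
  -- matrix coefficients of the representation `M`
  let coeff (m : M) (φ : Module.Dual K M) : Module.Dual K A :=
    { toFun := fun a => φ (α a m)
      map_add' := fun a a' => by simp
      map_smul' := fun k a => by simp }
  have coeff_apply (m : M) (φ : Module.Dual K M) (a : A) : coeff m φ a = φ (α a m) := rfl
  have span_coeff : Submodule.span K (Set.range fun x : M × Module.Dual K M => coeff x.1 x.2) = ⊤ :=
    Module.Dual.eq_top_of_separating _ fun a ha => ext_α fun m => ext_dual fun φ => by
      have := ha _ (Submodule.subset_span ⟨(m, φ), rfl⟩)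
      simpa [coeff_apply] using this
  have ε_coeff (m : M) (φ : Module.Dual K M) : ε (coeff m φ) = θ m φ :=
    ε₀_eq fun m' ψ => by
      rw [coeff_apply, θ_spec, θ_spec, ← sharp_spec, ← sharp_spec, τ_comm]
  -- a decomposition of `1` coming from the generator `M`
  let p' (j : Fin n) : M →ₗ[Bᵐᵒᵖ] B := p ∘ₗ LinearMap.single Bᵐᵒᵖ (fun _ => M) j
  let φ' (j : Fin n) : Module.Dual K M := τ ∘ₗ (p' j).restrictScalars K
  have sharp_φ' (j : Fin n) (m : M) : sharp (φ' j) m = p' j m :=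
    sharp_eq fun b => by simp [φ']
  have one_eq : ∑ j, p' j (i 1 j) = 1 := by
    have h1 : p (i 1) = 1 := LinearMap.congr_fun hip 1
    calc ∑ j, p' j (i 1 j) = p (∑ j, Pi.single j (i 1 j)) := (map_sum p _ _).symm
      _ = 1 := by rw [Finset.univ_sum_single, h1]
  have eq_sum (m : M) : ∑ j, MulOpposite.op (p' j (i 1 j)) • m = m := by
    have h : MulOpposite.op (∑ j, p' j (i 1 j)) = ∑ j, MulOpposite.op (p' j (i 1 j)) :=
      map_sum MulOpposite.opAddEquiv _ _
    rw [← Finset.sum_smul, ← h, one_eq, MulOpposite.op_one, one_smul]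
  refine ⟨ε, fun a c => ε₀_eq fun m ψ => ?_, fun a c => ε₀_eq fun m ψ => ?_, ?_, ?_, ?_⟩
  · have h : ψ (α (a * ε c) m) = pre ψ a (α (ε₀ c) m) := by simp [pre, ε]
    rw [h, ε₀_spec, ← θ_mul]
    rfl
  · have h : ψ (α (ε c * a) m) = ψ (α (ε₀ c) (α a m)) := by simp [ε]
    rw [h, ε₀_spec, ← mul_θ]
    rfl
  · intro c c' x
    have hc : c ∈ Submodule.span K (Set.range fun x : M × Module.Dual K M => coeff x.1 x.2) :=
      span_coeff ▸ Submodule.mem_top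
    have hc' : c' ∈ Submodule.span K (Set.range fun x : M × Module.Dual K M => coeff x.1 x.2) :=
      span_coeff ▸ Submodule.mem_top
    induction hc using Submodule.span_induction with
    | zero => simp
    | add c₁ c₂ _ _ h₁ h₂ => simp [mul_add, h₁, h₂]
    | smul k c _ h => simp [h]
    | mem c hc =>
      induction hc' using Submodule.span_induction with
      | zero => simp
      | add c₁ c₂ _ _ h₁ h₂ => simp [add_mul, h₁, h₂]
      | smul k c _ h => simp [h]
      | mem c' hc' =>
        obtain ⟨⟨m, φ⟩, rfl⟩ := hc
        obtain ⟨⟨m', φ'⟩, rfl⟩ := hc'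
        simp only [ε_coeff, coeff_apply, map_mul, Module.End.mul_apply, θ_spec, map_smul]
        rw [← sharp_spec, ← sharp_spec, τ_comm]
  · intro a ha
    refine ext_α fun m => ?_
    rw [← eq_sum m, map_sum, map_zero]
    refine Finset.sum_eq_zero fun j _ => ?_
    have h := ha (coeff m (φ' j))
    rw [ε_coeff] at h
    have h' := LinearMap.congr_fun (congrArg α h) (i 1 j)
    simpa [θ_spec, sharp_φ'] using h'
  · intro f hf
    have f_pre (m : M) (φ : Module.Dual K M) (a : A) :
        f (coeff m (pre φ a)) = f (coeff m φ) * a := by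
      rw [← hf]
      congr 1
      ext x
      simp [coeff_apply, pre]
    -- Write m' as the sum of the vectors `θ m' (φ' j) (i 1 j)` and absorb each θ into f by right
    -- linearity; symmetry of τ moves `sharp φ m'` onto m.
    have key (m : M) (φ : Module.Dual K M) (m' : M) : α (f (coeff m φ)) m' =
        ∑ j, α (f (coeff (MulOpposite.op (sharp φ m') • m) (φ' j))) (i 1 j) := by
      conv_lhs => rw [← eq_sum m', map_sum]
      refine Finset.sum_congr rfl fun j _ => ?_
      rw [← sharp_φ', ← θ_spec, ← Module.End.mul_apply, ← map_mul, ← f_pre]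
      congr 3
      ext x
      simp only [coeff_apply, pre, LinearMap.comp_apply, LinearMap.restrictScalars_apply, θ_spec,
        map_smul]
      rw [← sharp_spec, ← sharp_spec, τ_comm]
    have coeff_add (m m' : M) (φ : Module.Dual K M) :
        coeff (m + m') φ = coeff m φ + coeff m' φ := by
      ext x
      simp [coeff_apply]
    -- If f = aε, then f(`coeff m (φ' j)`) sends `i 1 j` to a(m · `p' j (i 1 j)`). Summing over j
    -- gives a(m), so this formula is forced.
    let a₀ : M →+ M := AddMonoidHom.mk' (fun m => ∑ j, α (f (coeff m (φ' j))) (i 1 j))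
      fun m m' => by simp [coeff_add, Finset.sum_add_distrib]
    have key' (m : M) (φ : Module.Dual K M) (m' : M) : α (f (coeff m φ)) m' =
        a₀ (MulOpposite.op (sharp φ m') • m) := key m φ m'
    have a₀_smul (b : Bᵐᵒᵖ) (m : M) : a₀ (b • m) = b • a₀ m := by
      have h : b • m = ∑ j, MulOpposite.op (sharp (φ' j) (b • i 1 j)) • m := by
        conv_lhs => rw [← eq_sum m, Finset.smul_sum]
        refine Finset.sum_congr rfl fun j _ => ?_
        rw [map_smul, sharp_φ', smul_smul]
        rfl
      rw [h, map_sum]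
      simp_rw [← key', map_smul, ← Finset.smul_sum]
      rfl
    refine ⟨α.symm { a₀ with map_smul' := a₀_smul }, fun c => ?_⟩
    have h : f = LinearMap.mulLeft K (α.symm { a₀ with map_smul' := a₀_smul }) ∘ₗ ε := by
      refine LinearMap.ext_on_range span_coeff fun x => ext_α fun m' => ?_
      rw [LinearMap.comp_apply, ε_coeff, key', LinearMap.mulLeft_apply, map_mul,
        AlgEquiv.apply_symm_apply, Module.End.mul_apply, θ_spec]
      rfl
    exact LinearMap.congr_fun h c

/-! ### Idempotents and idempotent ideals -/

/-- An element `x` of a finite-dimensional algebra that is not nilpotent has a nonzero idempotent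
multiple `x * y` with `y` commuting with `x`. -/
theorem exists_isIdempotentElem_mul {K A : Type*} [Field K] [Ring A] [Algebra K A]
    [FiniteDimensional K A] {x : A} (hx : ¬ IsNilpotent x) :
    ∃ y, Commute x y ∧ IsIdempotentElem (x * y) ∧ x * y ≠ 0 := by
  let S := Algebra.adjoin K {x}
  have hS : IsMulCommutative S := Algebra.isMulCommutative_adjoin K (by simp)
  let _ : CommRing S := { (inferInstance : Ring S) with mul_comm := hS.is_comm.comm }
  have : IsArtinianRing S := IsArtinianRing.of_finite K S
  let x' : S := ⟨x, Algebra.self_mem_adjoin_singleton K x⟩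
  -- The powers of x stabilise in the Artinian ring K[x]: xⁿ = xⁿ⁺¹y. Then xⁿ⁺¹yⁿ⁺¹ is idempotent
  -- and fixes xⁿ⁺¹, so it is nonzero.
  obtain ⟨n, y, hy⟩ := IsArtinian.exists_pow_succ_smul_dvd x' (1 : S)
  have h1 : x' ^ n = x' ^ (n + 1) * y := by simpa using hy.symm
  have h2 (k : ℕ) : x' ^ n = x' ^ (n + k) * y ^ k := by
    induction k with
    | zero => simp
    | succ k ih =>
      rw [ih, pow_add, h1]
      ring
  have h3 : x' ^ (n + 1) = x' ^ (n + 1) * (x' ^ (n + 1) * y ^ (n + 1)) := by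
    conv_lhs => rw [pow_succ, h2 (n + 1)]
    ring
  refine ⟨(x' ^ n * y ^ (n + 1) : S), ?_, ?_, fun h0 => hx ⟨n + 1, ?_⟩⟩
  · exact congrArg Subtype.val (mul_comm x' (x' ^ n * y ^ (n + 1)))
  · refine congrArg Subtype.val
      (a₁ := x' * (x' ^ n * y ^ (n + 1)) * (x' * (x' ^ n * y ^ (n + 1))))
      (a₂ := x' * (x' ^ n * y ^ (n + 1))) ?_
    calc _ = (x' ^ (n + 1) * (x' ^ (n + 1) * y ^ (n + 1))) * y ^ (n + 1) := by ring
      _ = _ := by rw [← h3]; ring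
  · have h0' : x' * (x' ^ n * y ^ (n + 1)) = 0 := Subtype.ext h0
    have : x' ^ (n + 1) = 0 := by
      rw [h3]
      calc _ = x' ^ (n + 1) * (x' * (x' ^ n * y ^ (n + 1))) := by ring
        _ = 0 := by rw [h0', mul_zero]
    exact congrArg Subtype.val this

section IdempotentIdeal

variable {K A : Type*} [Field K] [Ring A] [Algebra K A]

/-- The two-sided ideal generated by `e`, as a left ideal. -/
def twoSidedSpan (e : A) : Ideal A where
  __ := AddSubgroup.closure {z | ∃ a b, z = a * e * b}
  smul_mem' r x hx := by
    change x ∈ AddSubgroup.closure _ at hx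
    change r * x ∈ AddSubgroup.closure _
    induction hx using AddSubgroup.closure_induction with
    | mem x hx =>
      obtain ⟨a, b, rfl⟩ := hx
      exact AddSubgroup.subset_closure ⟨r * a, b, by simp only [mul_assoc]⟩
    | zero => simp
    | add x y _ _ hx hy => rw [mul_add]; exact add_mem hx hy
    | neg x _ hx => rw [mul_neg]; exact neg_mem hx

theorem mem_twoSidedSpan {e x : A} :
    x ∈ twoSidedSpan e ↔ x ∈ AddSubgroup.closure {z | ∃ a b, z = a * e * b} := Iff.rfl

theorem mul_mul_mem_twoSidedSpan (e a b : A) : a * e * b ∈ twoSidedSpan e :=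
  AddSubgroup.subset_closure ⟨a, b, rfl⟩

instance (e : A) : (twoSidedSpan e).IsTwoSided where
  mul_mem_of_left {x} r hx := by
    rw [mem_twoSidedSpan] at hx ⊢
    induction hx using AddSubgroup.closure_induction with
    | mem x hx =>
      obtain ⟨a, b, rfl⟩ := hx
      exact AddSubgroup.subset_closure ⟨a, b * r, by simp only [mul_assoc]⟩
    | zero => simp
    | add x y _ _ hx hy => rw [add_mul]; exact add_mem hx hy
    | neg x _ hx => rw [neg_mul]; exact neg_mem hx

/-- An idempotent ideal of a finite-dimensional algebra is generated by an idempotent. -/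
theorem exists_isIdempotentElem_le_twoSidedSpan [FiniteDimensional K A] (I : Submodule K A)
    (hl : ∀ a, ∀ x ∈ I, a * x ∈ I) (hr : ∀ a, ∀ x ∈ I, x * a ∈ I) (hI : I ≤ I * I) :
    ∃ e ∈ I, IsIdempotentElem e ∧ ∀ x ∈ I, x ∈ twoSidedSpan e := by
  -- Choose e so that the right ideal eA is maximal among those of idempotents in I.
  obtain ⟨_, ⟨e, ⟨he, hee⟩, rfl⟩, hmax⟩ :=
    (wellFounded_gt (α := Submodule K A)).has_min
      ((fun e => LinearMap.range (LinearMap.mulLeft K e)) '' {e | e ∈ I ∧ IsIdempotentElem e})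
      ⟨_, 0, ⟨zero_mem _, mul_zero _⟩, rfl⟩
  refine ⟨e, he, hee, ?_⟩
  have hee' : e * e = e := hee
  -- Otherwise a multiple of (1 - e)x(1 - e) is a nonzero idempotent f in I orthogonal to e, and (e
  -- + f)A is strictly larger than eA.
  have nil (x) (hx : x ∈ I) : IsNilpotent ((1 - e) * x * (1 - e)) := by
    by_contra hn
    obtain ⟨y, hy, hf, hf0⟩ := exists_isIdempotentElem_mul (K := K) hn
    set j := (1 - e) * x * (1 - e)
    have hej : e * j = 0 := by simp [j, ← mul_assoc, mul_sub, hee']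
    have hje : j * e = 0 := by simp [j, mul_assoc, sub_mul, hee']
    have hef : e * (j * y) = 0 := by rw [← mul_assoc, hej, zero_mul]
    have hfe : j * y * e = 0 := by rw [hy.eq, mul_assoc, hje, mul_zero]
    refine hmax _ ⟨e + j * y, ⟨add_mem he (hr _ _ (hr _ _ (hl _ _ hx))), ?_⟩, rfl⟩ ?_
    · rw [IsIdempotentElem, mul_add, add_mul, add_mul, hee', hef, hfe, hf.eq, add_zero, zero_add]
    · refine lt_of_le_of_ne ?_ fun heq => hf0 ?_
      · rintro _ ⟨z, rfl⟩
        refine ⟨e * z, ?_⟩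
        simp only [LinearMap.mulLeft_apply]
        rw [← mul_assoc, add_mul, hee', hfe, add_zero]
      · have : j * y ∈ LinearMap.range (LinearMap.mulLeft K e) := by
          change _ = LinearMap.range (LinearMap.mulLeft K (e + j * y)) at heq
          change j * y ∈ (fun e => LinearMap.range (LinearMap.mulLeft K e)) e
          rw [heq]
          exact ⟨j * y, by simp [add_mul, hef, hf.eq]⟩
        obtain ⟨z, hz⟩ := this
        rw [LinearMap.mulLeft_apply] at hz
        rw [← hef, ← hz, ← mul_assoc, hee']
  have : IsArtinianRing A := IsArtinianRing.of_finite K A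
  have : IsArtinianRing (A ⧸ twoSidedSpan e) :=
    (Ideal.Quotient.mk_surjective (I := twoSidedSpan e)).isArtinianRing
  let π := Ideal.Quotient.mk (twoSidedSpan e)
  have nil' (x) (hx : x ∈ I) : IsNilpotent (π x) := by
    have h : π x = π ((1 - e) * x * (1 - e)) := by
      rw [Ideal.Quotient.eq]
      have : x - (1 - e) * x * (1 - e) = 1 * e * x + x * e * 1 - 1 * e * (x * e) := by
        noncomm_ring
      rw [this]
      exact sub_mem (add_mem (mul_mul_mem_twoSidedSpan _ _ _) (mul_mul_mem_twoSidedSpan _ _ _))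
        (mul_mul_mem_twoSidedSpan _ _ _)
    rw [h]
    exact (nil x hx).map π
  have jac (x) (hx : x ∈ I) : π x ∈ Ideal.jacobson (⊥ : Ideal (A ⧸ twoSidedSpan e)) := by
    rw [Ideal.mem_jacobson_iff]
    intro y
    obtain ⟨y, rfl⟩ := Ideal.Quotient.mk_surjective y
    have hu : IsUnit (1 + π (y * x)) := (nil' _ (hl y x hx)).isUnit_one_add
    obtain ⟨u, hu⟩ := hu
    refine ⟨(u⁻¹ : _), ?_⟩
    rw [Ideal.mem_bot, sub_eq_zero, mul_assoc]
    change _ * (π y * π x) + _ = _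
    rw [← map_mul, ← Units.inv_mul u, hu]
    noncomm_ring
  obtain ⟨n, hn⟩ := IsArtinianRing.isNilpotent_jacobson_bot (R := A ⧸ twoSidedSpan e)
  -- The image of I in A/AeA lies in the Jacobson radical; as I ⊆ I², it lies in every power of this
  -- nilpotent ideal, hence is zero.
  have pow (k : ℕ) : ∀ x ∈ I, π x ∈ Ideal.jacobson (⊥ : Ideal (A ⧸ twoSidedSpan e)) ^ k := by
    induction k with
    | zero => exact fun x _ => by rw [Submodule.pow_zero, Ideal.one_eq_top]; trivial
    | succ k ih =>
      refine fun x hx => Submodule.mul_induction_on (hI hx) (fun y hy z hz => ?_)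
        fun y z hy hz => ?_
      · rw [map_mul, Submodule.pow_succ]
        exact Submodule.mul_mem_mul (ih y hy) (jac z hz)
      · rw [map_add]
        exact add_mem hy hz
  intro x hx
  have := pow n x hx
  rw [hn] at this
  exact Ideal.Quotient.eq_zero_iff_mem.1 this

end IdempotentIdeal

/-! ### The corner eAe and its right module Ae -/

section Corner

variable {K : Type u} [Field K] {A : Type u} [Ring A] [Algebra K A] {e : A}

instance IsIdempotentElem.Corner.instAlgebra (he : IsIdempotentElem e) : Algebra K he.Corner where
  smul k b := ⟨k • b.1, by
    obtain ⟨a, ha⟩ := b.2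
    exact ⟨k • a, by simp [← ha]⟩⟩
  algebraMap :=
    { toFun := fun k => ⟨k • e, k • e, by simp [he.eq]⟩
      map_one' := Subtype.ext (one_smul K e)
      map_mul' := fun k l => Subtype.ext (by
        change (k * l) • e = k • e * l • e
        rw [smul_mul_smul_comm, he.eq])
      map_zero' := Subtype.ext (zero_smul K e)
      map_add' := fun k l => Subtype.ext (add_smul k l e) }
  commutes' k b := Subtype.ext (by
    have hb := (Subsemigroup.mem_corner_iff he).1 b.2
    change k • e * b.1 = b.1 * k • e
    simp [hb.1, hb.2])
  smul_def' k b := Subtype.ext (by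
    have hb := (Subsemigroup.mem_corner_iff he).1 b.2
    change k • b.1 = k • e * b.1
    simp [hb.1])

/-- The inclusion of a corner `e A e` in `A`. -/
def IsIdempotentElem.Corner.val (K : Type u) [Field K] {A : Type u} [Ring A] [Algebra K A] {e : A}
    (he : IsIdempotentElem e) : he.Corner →ₗ[K] A where
  toFun b := b.1
  map_add' _ _ := rfl
  map_smul' _ _ := rfl

/-- The right module `A e` over the corner `e A e`, as a subspace of `A`. -/
def leftSpan (K : Type u) [Field K] {A : Type u} [Ring A] [Algebra K A] (e : A) :
    Submodule K A where
  carrier := {m | m * e = m}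
  zero_mem' := zero_mul e
  add_mem' {a b} ha hb := by
    simp only [Set.mem_ofPred_eq] at ha hb ⊢
    rw [add_mul, ha, hb]
  smul_mem' k a ha := by
    simp only [Set.mem_ofPred_eq] at ha ⊢
    rw [smul_mul_assoc, ha]

/-- The right module `A e` over the corner `e A e`. -/
def IsIdempotentElem.LeftModule (K : Type u) [Field K] {A : Type u} [Ring A] [Algebra K A] {e : A}
    (_ : IsIdempotentElem e) : Type u := leftSpan K e

namespace IsIdempotentElem.LeftModule

variable (he : IsIdempotentElem e)

instance : AddCommGroup (he.LeftModule K) := inferInstanceAs (AddCommGroup (leftSpan K e))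

instance : Module K (he.LeftModule K) := inferInstanceAs (Module K (leftSpan K e))

/-- The inclusion of `A e` in `A`. -/
def val : he.LeftModule K →ₗ[K] A := (leftSpan K e).subtype

variable {he}

theorem val_injective : Function.Injective (val (K := K) he) := Subtype.val_injective

theorem val_mul (m : he.LeftModule K) : val he m * e = val he m := m.2

/-- An element `m` of `A` with `m * e = m` as an element of `A e`. -/
def mk (m : A) (hm : m * e = m) : he.LeftModule K := ⟨m, hm⟩

theorem val_mk (m : A) (hm : m * e = m) : val (K := K) he (mk m hm) = m := rfl

instance : SMul he.Cornerᵐᵒᵖ (he.LeftModule K) where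
  smul b m := mk (val he m * b.unop.1) (by
    rw [mul_assoc, ((Subsemigroup.mem_corner_iff he).1 b.unop.2).2])

theorem val_smul (b : he.Cornerᵐᵒᵖ) (m : he.LeftModule K) :
    val he (b • m) = val he m * b.unop.1 := rfl

instance : Module he.Cornerᵐᵒᵖ (he.LeftModule K) where
  one_smul m := val_injective (val_mul m)
  mul_smul a b m := val_injective (mul_assoc (val he m) b.unop.1 a.unop.1).symm
  smul_zero a := val_injective (by simp [val_smul])
  smul_add a m m' := val_injective (by simp [val_smul, add_mul])
  add_smul a b m := val_injective (mul_add (val he m) a.unop.1 b.unop.1)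
  zero_smul m := val_injective (mul_zero (val he m))

instance : IsScalarTower K he.Cornerᵐᵒᵖ (he.LeftModule K) where
  smul_assoc k a m := val_injective (by
    rw [(val he).map_smul, val_smul, val_smul]
    exact mul_smul_comm k (val he m) a.unop.1)

/-- Left multiplication by e splits the inclusion of eAe in Ae, so one copy of Ae suffices. -/
theorem isRightGenerator : IsRightGenerator he.Corner (he.LeftModule K) := by
  have hb (b : he.Corner) := (Subsemigroup.mem_corner_iff he).1 b.2
  refine ⟨1,
    { toFun := fun b _ => mk b.1 (hb b).2
      map_add' := fun _ _ => rfl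
      map_smul' := fun _ _ => rfl },
    { toFun := fun f => ⟨e * val he (f 0), val he (f 0), by
        change e * val he (f 0) * e = _
        rw [mul_assoc, val_mul]⟩
      map_add' := fun f g => Subtype.ext (mul_add e (val he (f 0)) (val he (g 0)))
      map_smul' := fun b f =>
        Subtype.ext (mul_assoc e (val he (f 0)) b.unop.1).symm }, ?_⟩
  exact LinearMap.ext fun b => Subtype.ext (hb b).1

instance [FiniteDimensional K A] : FiniteDimensional K (he.LeftModule K) :=
  FiniteDimensional.of_injective (val he) val_injective

/-- The action of `A` on `A e` by left multiplication. -/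
def toEnd : A →ₐ[K] Module.End he.Cornerᵐᵒᵖ (he.LeftModule K) where
  toFun a :=
    { toFun := fun m => mk (a * val he m) (by rw [mul_assoc, val_mul])
      map_add' := fun m m' => val_injective (mul_add a (val he m) (val he m'))
      map_smul' := fun b m => val_injective (mul_assoc a (val he m) b.unop.1).symm }
  map_one' := LinearMap.ext fun m => val_injective (one_mul _)
  map_mul' a b := LinearMap.ext fun m => val_injective (mul_assoc _ _ _)
  map_zero' := LinearMap.ext fun m => val_injective (zero_mul _)
  map_add' a b := LinearMap.ext fun m => val_injective (add_mul _ _ _)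
  commutes' k := LinearMap.ext fun m => val_injective (by
    rw [Module.algebraMap_end_apply, map_smul, Algebra.smul_def]; rfl)

theorem val_toEnd (a : A) (m : he.LeftModule K) : val he (toEnd a m) = a * val he m := rfl

end IsIdempotentElem.LeftModule

end Corner

/-! ### From ε to a gendo-symmetric presentation -/

namespace IsNakayamaCounit

open IsIdempotentElem

variable {K : Type u} [Field K] {A : Type u} [Ring A] [Algebra K A]
variable {ε : Module.Dual K A →ₗ[K] A}

/-- Replace a preimage θ₀ of e by eθ₀e; the last identity is the exchange identity for θ and bθ. -/
theorem exists_trace (hε : IsNakayamaCounit ε) {e : A} (he : IsIdempotentElem e)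
    (h : e ∈ LinearMap.range ε) :
    ∃ θ : Module.Dual K A, ε θ = e ∧ (∀ x, θ (x * e) = θ x) ∧
      ∀ x b, θ (x * e * b) = θ (b * e * x) := by
  obtain ⟨θ₀, h₀⟩ := h
  set θ := (θ₀ ∘ₗ LinearMap.mulLeft K e) ∘ₗ LinearMap.mulRight K e with hθ
  have he' : e * e = e := he
  have h1 : ε θ = e := by rw [hθ, hε.map_mulRight, hε.map_mulLeft, h₀, he', he']
  have h2 (x : A) : θ (x * e) = θ x := by simp [hθ, mul_assoc, he']
  refine ⟨θ, h1, h2, fun x b => ?_⟩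
  have := hε.comm θ (θ ∘ₗ LinearMap.mulRight K b) x
  rwa [hε.map_mulRight b θ, h1] at this

variable [FiniteDimensional K A]

theorem exists_idempotent (hε : IsNakayamaCounit ε) :
    ∃ e ∈ LinearMap.range ε, IsIdempotentElem e ∧ ∀ a, (∀ x, a * x * e = 0) → a = 0 := by
  have hl (a x : A) (hx : x ∈ LinearMap.range ε) : a * x ∈ LinearMap.range ε := by
    obtain ⟨c, rfl⟩ := hx
    exact ⟨_, hε.map_mulRight a c⟩
  have hr (a x : A) (hx : x ∈ LinearMap.range ε) : x * a ∈ LinearMap.range ε := by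
    obtain ⟨c, rfl⟩ := hx
    exact ⟨_, hε.map_mulLeft a c⟩
  -- Faithfulness says that the functionals ε(c)c' separate points, so they span D(A); applying ε
  -- shows that its image lies in its own square.
  have hS : Submodule.span K (Set.range fun x : Module.Dual K A × Module.Dual K A =>
      x.2 ∘ₗ LinearMap.mulRight K (ε x.1)) = ⊤ :=
    Module.Dual.eq_top_of_separating _ fun a ha => hε.faithful a fun c =>
      (Module.forall_dual_apply_eq_zero_iff K _).1 fun c' =>
        ha _ (Submodule.subset_span ⟨(c, c'), rfl⟩)
  have hI : LinearMap.range ε ≤ LinearMap.range ε * LinearMap.range ε := by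
    rw [LinearMap.range_eq_map, ← hS, Submodule.map_span_le]
    rintro _ ⟨⟨c, c'⟩, rfl⟩
    dsimp only
    rw [hε.map_mulRight, hS, ← LinearMap.range_eq_map]
    exact Submodule.mul_mem_mul ⟨c, rfl⟩ ⟨c', rfl⟩
  obtain ⟨e, he, hee, h⟩ := exists_isIdempotentElem_le_twoSidedSpan _ hl hr hI
  refine ⟨e, he, hee, fun a ha => hε.faithful a fun c => ?_⟩
  have := h (ε c) ⟨c, rfl⟩
  rw [mem_twoSidedSpan] at this
  generalize ε c = y at this
  induction this using AddSubgroup.closure_induction with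
  | mem x hx =>
    obtain ⟨x, y, rfl⟩ := hx
    rw [← mul_assoc, ← mul_assoc, ha, zero_mul]
  | zero => exact mul_zero a
  | add x y _ _ hx hy => rw [mul_add, hx, hy, add_zero]
  | neg x _ hx => rw [mul_neg, hx, neg_zero]

/-- The form is θ(bx) on eAe. If it vanishes for all x in eAe, then θb = 0 on A, whence b = eb =
ε(θb) = 0. -/
theorem isSymmetricAlg_corner (hε : IsNakayamaCounit ε) {e : A} (he : IsIdempotentElem e)
    (h : e ∈ LinearMap.range ε) : IsSymmetricAlg K he.Corner := by
  obtain ⟨θ, h1, h2, h4⟩ := hε.exists_trace he h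
  have hb (b : he.Corner) := (Subsemigroup.mem_corner_iff he).1 b.2
  have hfin : FiniteDimensional K he.Corner :=
    FiniteDimensional.of_injective (Corner.val K he) Subtype.val_injective
  let φ : he.Corner →ₗ[K] Module.Dual K he.Corner :=
    { toFun := fun b => θ ∘ₗ LinearMap.mulLeft K b.1 ∘ₗ Corner.val K he
      map_add' := fun b b' => LinearMap.ext fun x => by
        change θ ((b.1 + b'.1) * x.1) = θ (b.1 * x.1) + θ (b'.1 * x.1)
        rw [add_mul, map_add]
      map_smul' := fun k b => LinearMap.ext fun x => by
        change θ ((k • b.1) * x.1) = k • θ (b.1 * x.1)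
        rw [smul_mul_assoc, map_smul] }
  have hφ : Function.Injective φ := by
    rw [injective_iff_map_eq_zero]
    intro b h0
    have key : θ ∘ₗ LinearMap.mulLeft K b.1 = 0 := LinearMap.ext fun x => by
      have h5 := LinearMap.congr_fun h0 ⟨e * x * e, x, rfl⟩
      change θ (b.1 * (e * x * e)) = 0 at h5
      rwa [← mul_assoc, h2, ← mul_assoc, (hb b).2] at h5
    have h6 := hε.map_mulLeft b.1 θ
    rw [key, h1, map_zero, (hb b).1] at h6
    exact Subtype.ext h6.symm
  refine ⟨hfin, LinearMap.linearEquivOfInjective φ hφ Subspace.dual_finrank_eq.symm,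
    fun b y c x => ?_⟩
  change θ (b.1 * y.1 * c.1 * x.1) = θ (y.1 * (c.1 * x.1 * b.1))
  have h5 := h4 (y.1 * c.1 * x.1) b.1
  rw [(hb b).2, mul_assoc _ e, (hb b).1] at h5
  simp only [mul_assoc] at h5 ⊢
  exact h5.symm

open TensorProduct in
-- For surjectivity, g is turned into a right linear map D(A) → A sending xθy to g(xe)y. Fullness
-- writes it as aε, and evaluating at mθ gives g(m) = am.
theorem bijective_toEnd (hε : IsNakayamaCounit ε) {e : A} (he : IsIdempotentElem e)
    (h : e ∈ LinearMap.range ε) (faithful : ∀ a, (∀ x, a * x * e = 0) → a = 0) :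
    Function.Bijective (LeftModule.toEnd (K := K) (he := he)) := by
  obtain ⟨θ, h1, -, -⟩ := hε.exists_trace he h
  have he' : e * e = e := he
  constructor
  · rw [injective_iff_map_eq_zero]
    refine fun a ha => faithful a fun x => ?_
    have := congrArg (LeftModule.val he)
      (LinearMap.congr_fun ha (LeftModule.mk (x * e) (by rw [mul_assoc, he'])))
    rwa [LeftModule.val_toEnd, LeftModule.val_mk, ← mul_assoc] at this
  · intro g
    -- the extension of `g` to `A`
    let proj : A →ₗ[K] he.LeftModule K :=
      { toFun := fun x => LeftModule.mk (x * e) (by rw [mul_assoc, he'])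
        map_add' := fun x y => LeftModule.val_injective (add_mul x y e)
        map_smul' := fun k x => LeftModule.val_injective (smul_mul_assoc k x e) }
    let g' : A →ₗ[K] A := LeftModule.val he ∘ₗ g.restrictScalars K ∘ₗ proj
    have g'_mul_e (x : A) : g' x * e = g' x := LeftModule.val_mul _
    have g'_mul (x y : A) : g' x * (e * y * e) = g' (x * e * y) := by
      let b : he.Corner := ⟨e * y * e, y, rfl⟩
      have hp : proj (x * e * y) = MulOpposite.op b • proj x := LeftModule.val_injective (by
        change x * e * y * e = x * e * (e * y * e)
        simp only [← mul_assoc, mul_assoc x e e, he'])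
      change _ = LeftModule.val he (g (proj (x * e * y)))
      rw [hp, map_smul]
      rfl
    let T : A ⊗[K] A →ₗ[K] Module.Dual K A := TensorProduct.lift (LinearMap.mk₂ K
      (fun x y => (θ ∘ₗ LinearMap.mulLeft K y) ∘ₗ LinearMap.mulRight K x)
      (fun x x' y => by ext; simp [mul_add]) (fun k x y => by ext; simp)
      (fun x y y' => by ext; simp [add_mul]) (fun k x y => by ext; simp))
    have T_tmul (x y : A) :
        T (x ⊗ₜ y) = (θ ∘ₗ LinearMap.mulLeft K y) ∘ₗ LinearMap.mulRight K x := by simp [T]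
    have ε_T (x y : A) : ε (T (x ⊗ₜ y)) = x * (e * y) := by
      rw [T_tmul, hε.map_mulRight, hε.map_mulLeft, h1]
    have T_surj : Function.Surjective T := by
      rw [← LinearMap.range_eq_top]
      refine Module.Dual.eq_top_of_separating _ fun a ha => faithful a fun x => ?_
      have key : θ ∘ₗ LinearMap.mulRight K (a * x) = 0 := LinearMap.ext fun y => by
        have := ha _ ⟨x ⊗ₜ y, rfl⟩
        rw [T_tmul] at this
        simpa [mul_assoc] using this
      rw [← h1, ← hε.map_mulRight, key, map_zero]
    let S : A ⊗[K] A →ₗ[K] A := TensorProduct.lift (LinearMap.mk₂ K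
      (fun x y => g' x * (e * y))
      (fun x x' y => by simp [add_mul]) (fun k x y => by simp)
      (fun x y y' => by simp [mul_add]) (fun k x y => by simp))
    have S_tmul (x y : A) : S (x ⊗ₜ y) = g' x * (e * y) := by simp [S]
    -- This makes the map well defined: if T t = 0, then S t annihilates Ae, so S t = 0 by
    -- faithfulness and S factors through T.
    have S_mul (t : A ⊗[K] A) (z : A) : S t * z * e = g' (ε (T t) * z) := by
      induction t with
      | zero => simp
      | add t t' ht ht' => simp only [map_add, add_mul, ht, ht']
      | tmul x y =>
        have := g'_mul x (y * z)
        rw [S_tmul, ε_T]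
        simp only [mul_assoc] at this ⊢
        exact this
    have S_eq_zero (t : A ⊗[K] A) (ht : T t = 0) : S t = 0 :=
      faithful _ fun z => by rw [S_mul, ht]; simp
    obtain ⟨σ, hσ⟩ := T.exists_rightInverse_of_surjective (LinearMap.range_eq_top.2 T_surj)
    have hσ' (c) : T (σ c) = c := LinearMap.congr_fun hσ c
    have S_σ (t : A ⊗[K] A) : S (σ (T t)) = S t := by
      rw [← sub_eq_zero, ← map_sub]
      exact S_eq_zero _ (by rw [map_sub, hσ', sub_self])
    obtain ⟨a, ha⟩ := hε.full (S ∘ₗ σ) fun a c => by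
      obtain ⟨t, rfl⟩ := T_surj c
      let R : A ⊗[K] A →ₗ[K] A ⊗[K] A := TensorProduct.map LinearMap.id (LinearMap.mulRight K a)
      have hT : T t ∘ₗ LinearMap.mulLeft K a = T (R t) := by
        induction t with
        | zero => simp
        | add t t' ht ht' => simp only [map_add, LinearMap.add_comp, ht, ht']
        | tmul x y =>
          simp only [R, TensorProduct.map_tmul, T_tmul]
          ext z
          simp [mul_assoc]
      have hS : S (R t) = S t * a := by
        clear hT
        induction t with
        | zero => simp
        | add t t' ht ht' => simp only [map_add, add_mul, ht, ht']
        | tmul x y => simp [R, S_tmul, mul_assoc]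
      rw [LinearMap.comp_apply, LinearMap.comp_apply, hT, S_σ, S_σ, hS]
    refine ⟨a, LinearMap.ext fun m => LeftModule.val_injective ?_⟩
    have key := ha (T (LeftModule.val he m ⊗ₜ 1))
    rw [LinearMap.comp_apply, S_σ, S_tmul, ε_T, mul_one, g'_mul_e, LeftModule.val_mul] at key
    rw [LeftModule.val_toEnd, ← key]
    have hm : proj (LeftModule.val he m) = m := LeftModule.val_injective (LeftModule.val_mul m)
    change LeftModule.val he (g (proj _)) = _
    rw [hm]

theorem isGendoSymmetric (hε : IsNakayamaCounit ε) : IsGendoSymmetric K A := by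
  obtain ⟨e, h, he, faithful⟩ := hε.exists_idempotent
  exact ⟨he.Corner, inferInstance, inferInstance, he.LeftModule K, inferInstance, inferInstance,
    inferInstance, inferInstance, hε.isSymmetricAlg_corner he h, inferInstance,
    LeftModule.isRightGenerator, ⟨AlgEquiv.ofBijective _ (hε.bijective_toEnd he h faithful)⟩⟩

end IsNakayamaCounit

theorem mainTheorem4 (K : Type u) [Field K] (A : Type u) [Ring A] [Algebra K A]
    [FiniteDimensional K A] :
    IsGendoSymmetric K A ↔ ∃ G : Comonad (FGModuleCat.{u} Aᵐᵒᵖ), G.toFunctor = nakayamaFunctor K A := by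
  constructor
  · intro h
    obtain ⟨ε, hε⟩ := h.exists_isNakayamaCounit
    exact hε.exists_comonad
  · intro h
    obtain ⟨ε, hε⟩ := exists_isNakayamaCounit_of_comonad h
    exact hε.isGendoSymmetric
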